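/- **Theorem 3.1.** Consider the CLIQUE (congested clique) model: the vertex set is $[n]$, and in each synchronous round every vertex sends to every other vertex a message of $B$ bits (possibly different messages to different vertices), local computation being unrestricted. For a hypergraph $H=(V,E)$ on $V=[n]$, each vertex initially knows $n$, $r$, $B$, its own identity, and the set of hyperedges that contain it (each given as a set of vertices). A *triangle* of $H$ is a closed path $v_0,e_0,v_1,e_1,v_2,e_2,v_0$ of length 3, i.e. $e_i\in E$ and $v_i,v_{i+1}\in e_i$ for $i\in\mathbb{Z}/3$, considered up to the choice of starting vertex and direction. It is *simple* if $v_0,v_1,v_2$ are distinct and $e_0,e_1,e_2$ are distinct, and *induced* if moreover $v_i\notin e_{i+1}$ for all $i\in\mathbb{Z}/3$. In the *triangle enumeration problem* each vertex $v$ has to output a set $S_v$ of triangles such that the sets $S_v$ are pairwise disjoint and $\bigcup_{v} S_v$ is the set of all triangles of $H$; in the two variants of the problem, only the simple triangles, respectively only the induced triangles, are to be output. Let $B=\Theta(\log n)$. Then triangle enumeration, in each of the three variants, can be solved deterministically in $O(n^{r-5/3}/\log n)$ rounds of the CLIQUE model on $r$-uniform hypergraphs. Precisely: for every $c>0$ there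 is a constant $C>0$, depending only on $c$, such that for all integers $r\ge 0$, $n\ge 2$ and $B\ge c\log n$ there are an integer $0\le T\le C\,n^{r-5/3}/\log n$ and a deterministic algorithm with $B$-bit messages that solves triangle enumeration within $T$ rounds on every $r$-uniform hypergraph with vertex set $[n]$. -/

import Mathlib

namespace CliqueModel

/-! ### Hypergraphs and their triangles -/

/-- `H` is a hypergraph on the whole vertex type `α` all of whose edges have exactly `r` vertices. -/
def IsUniformOn {α : Type} (H : Hypergraph α) (r : ℕ) : Prop :=
  H.vertexSet = Set.univ ∧ ∀ e ∈ H.edgeSet, e.ncard = r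

/-- A cyclic sequence `v 0, e 0, v 1, e 1, v 2, e 2, v 0` of vertices and vertex sets;
indices are computed modulo 3. -/
@[ext]
structure TriSeq (α : Type) where
  v : Fin 3 → α
  e : Fin 3 → Set α

namespace TriSeq

variable {α : Type}

/-- The sequence is a closed path of length 3 in `H`: `e i` is an edge containing
`v i` and `v (i + 1)`. -/
def IsTriangle (H : Hypergraph α) (t : TriSeq α) : Prop :=
  ∀ i, t.e i ∈ H.edgeSet ∧ t.v i ∈ t.e i ∧ t.v (i + 1) ∈ t.e i

/-- The three vertices are distinct and the three edges are distinct. -/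
def IsSimple (t : TriSeq α) : Prop :=
  Function.Injective t.v ∧ Function.Injective t.e

/-- Simple, and no vertex lies on the opposite edge. -/
def IsInduced (t : TriSeq α) : Prop :=
  t.IsSimple ∧ ∀ i, t.v i ∉ t.e (i + 1)

/-- Two sequences describe the same cycle if they differ by the choice of the starting vertex
(first alternative), or by that choice and the direction of traversal (second alternative). -/
def SameCycle (s t : TriSeq α) : Prop :=
  (∃ k : Fin 3, ∀ i, t.v i = s.v (k + i) ∧ t.e i = s.e (k + i)) ∨
  (∃ k : Fin 3, ∀ i, t.v i = s.v (k - i) ∧ t.e i = s.e (k - i - 1))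

theorem sameCycle_refl (s : TriSeq α) : SameCycle s s :=
  Or.inl ⟨0, fun i => by simp⟩

theorem sameCycle_symm {s t : TriSeq α} (h : SameCycle s t) : SameCycle t s := by
  rcases h with ⟨k, h⟩ | ⟨k, h⟩
  · refine Or.inl ⟨-k, fun i => ?_⟩
    rw [(h (-k + i)).1, (h (-k + i)).2, add_neg_cancel_left]
    exact ⟨rfl, rfl⟩
  · refine Or.inr ⟨k, fun i => ?_⟩
    rw [(h (k - i)).1, (h (k - i - 1)).2]
    have h1 : k - (k - i) = i := by abel
    have h2 : k - (k - i - 1) - 1 = i := by abel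
    rw [h1, h2]
    exact ⟨rfl, rfl⟩

theorem sameCycle_trans {s t u : TriSeq α} (h : SameCycle s t) (h' : SameCycle t u) :
    SameCycle s u := by
  rcases h with ⟨k, h⟩ | ⟨k, h⟩ <;> rcases h' with ⟨l, h'⟩ | ⟨l, h'⟩
  · refine Or.inl ⟨k + l, fun i => ?_⟩
    rw [(h' i).1, (h' i).2, (h _).1, (h _).2, add_assoc]
    exact ⟨rfl, rfl⟩
  · refine Or.inr ⟨k + l, fun i => ?_⟩
    rw [(h' i).1, (h' i).2, (h _).1, (h _).2]
    have h1 : k + (l - i) = k + l - i := by abel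
    have h2 : k + (l - i - 1) = k + l - i - 1 := by abel
    rw [h1, h2]
    exact ⟨rfl, rfl⟩
  · refine Or.inr ⟨k - l, fun i => ?_⟩
    rw [(h' i).1, (h' i).2, (h _).1, (h _).2, sub_add_eq_sub_sub]
    exact ⟨rfl, rfl⟩
  · refine Or.inl ⟨k - l, fun i => ?_⟩
    rw [(h' i).1, (h' i).2, (h _).1, (h _).2]
    have h1 : k - (l - i) = k - l + i := by abel
    have h2 : k - (l - i - 1) - 1 = k - l + i := by abel
    rw [h1, h2]
    exact ⟨rfl, rfl⟩

end TriSeq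

instance triSetoid (α : Type) : Setoid (TriSeq α) where
  r := TriSeq.SameCycle
  iseqv := ⟨TriSeq.sameCycle_refl, TriSeq.sameCycle_symm, TriSeq.sameCycle_trans⟩

/-- Cycles of length 3, without a distinguished starting vertex or direction. -/
abbrev Tri (α : Type) : Type := Quotient (triSetoid α)

/-- The three usual variants of the enumeration task. -/
inductive TriKind
  | all
  | simple
  | induced

/-- The predicate that selects the triangles of the given kind. -/
def TriKind.Selects {α : Type} : TriKind → TriSeq α → Prop
  | .all, _ => True
  | .simple, t => t.IsSimple
  | .induced, t => t.IsInduced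

/-- The set of triangles of `H` of the given kind. -/
def triangles {α : Type} (kind : TriKind) (H : Hypergraph α) : Set (Tri α) :=
  {T | ∃ t : TriSeq α, Quotient.mk (triSetoid α) t = T ∧ t.IsTriangle H ∧ kind.Selects t}

/-- The output sets `S v` solve triangle enumeration on `H`: they are pairwise disjoint, and
together they consist of exactly the triangles of `H`. -/
def Enumerates {α : Type} (kind : TriKind) (H : Hypergraph α) (S : α → Set (Tri α)) : Prop :=
  Pairwise (fun u v => Disjoint (S u) (S v)) ∧ ⋃ v, S v = triangles kind H

/-! ### The CLIQUE model -/

/-- A deterministic synchronous algorithm on vertex set `V` in which, in each round, every vertex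
sends to every vertex a `B`-bit message, possibly different messages to different vertices. Local
computation and memory are unrestricted. `I` is the type of local inputs and `O` that of local
outputs. (A vertex may formally also send a message to itself; as it already knows the content,
this gives it no additional power.) -/
structure Algorithm (V I O : Type) (B : ℕ) where
  /-- local memory -/
  State : Type
  /-- initial memory of a vertex, from its identity and its local input -/
  init : V → I → State
  /-- `send s w` is the message to `w` sent by a vertex with memory `s` -/
  send : State → V → (Fin B → Bool)
  /-- new memory, from the old one and the messages received in the round, indexed by sender -/
  step : State → (V → (Fin B → Bool)) → State
  /-- local output -/
  output : State → O

namespace Algorithm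

variable {V I O : Type} {B : ℕ}

/-- The memory of each vertex after the given number of rounds on input `x`. -/
def run (A : Algorithm V I O B) (x : V → I) : ℕ → V → A.State
  | 0, v => A.init v (x v)
  | t + 1, v => A.step (A.run x t v) (fun u => A.send (A.run x t u) v)

/-- The local outputs if the execution is stopped after `T` rounds. -/
def result (A : Algorithm V I O B) (x : V → I) (T : ℕ) (v : V) : O :=
  A.output (A.run x T v)

end Algorithm

/-- What `v` knows initially about `H` (its 1-neighbourhood): its incident edges, each given
as the set of the vertices it contains. -/
def localInput {V : Type} (H : Hypergraph V) (v : V) : Set (Set V) :=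
  {e | e ∈ H.edgeSet ∧ v ∈ e}

/-- There is an algorithm in the CLIQUE model with `n` vertices `0, …, n - 1` and `B`-bit messages
that solves triangle enumeration in `T` rounds on every `r`-uniform hypergraph. The algorithm may
depend on `n`, `r`, `B`, but learns about the hypergraph only through the local inputs. -/
def SolvableIn (kind : TriKind) (r n B T : ℕ) : Prop :=
  ∃ A : Algorithm (Fin n) (Set (Set (Fin n))) (Set (Tri (Fin n))) B,
    ∀ H : Hypergraph (Fin n), IsUniformOn H r →
      Enumerates kind H (A.result (localInput H) T)

end CliqueModel

namespace CliqueModel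

/-! Let `k` be the integer part of the cube root of `n`. The three lowest base-`k` digits of a
vertex `w` select three residue classes modulo `k`, whose union `Q w` has O(`k ^ 2`) elements. Since
`k ^ 3 ≤ n`, any three vertices lie in a common `Q w`. If `w` learns every edge that meets `Q w` at
least twice, it therefore knows all triangles with three distinct vertices in `Q w`. A triangle with
a repeated vertex is already known to that vertex.

For `r ≥ 2`, about `k ^ 4 * n ^ (r - 2)` vertex sets concern a given `w`. Spread evenly over its `n`
links, this is O(`k * n ^ (r - 2)`) per link. A single bit per potential edge suffices, because the
schedule is fixed in advance and no edge names are sent. Dividing by `B` gives the bound.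

The even spreading is a two-hop route from an owner of the edge through an intermediate vertex to
`w`; the intermediate vertex depends on the vertex set alone. The load bounds are
`exists_routing_of_two` and `exists_routing_of_three_le`; `solvableIn_of_routing` turns them into an
algorithm, and `solvableIn_of_computableIn` assigns each triangle to one vertex. -/

/-- Some algorithm computes the local outputs `f x v` from the local inputs `x` in `T` rounds. -/
def ComputableIn {V I O : Type} (B T : ℕ) (f : (V → I) → V → O) : Prop :=
  ∃ A : Algorithm V I O B, ∀ x v, A.result x T v = f x v

/-! ### Composition of algorithms and scheduled communication -/

namespace ComputableIn

variable {V I J O : Type} {B T T' : ℕ}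

theorem map {f : (V → I) → V → J} (hf : ComputableIn B T f) (g : J → O) :
    ComputableIn B T (fun x v => g (f x v)) := by
  obtain ⟨A, hA⟩ := hf
  let A' : Algorithm V I O B :=
    { State := A.State, init := A.init, send := A.send, step := A.step,
      output := fun s => g (A.output s) }
  have hrun : ∀ x t v, A'.run x t v = A.run x t v := by
    intro x t
    induction t with
    | zero => intro v; rfl
    | succ t ih => intro v; simp only [Algorithm.run, ih]; rfl
  refine ⟨A', fun x v => ?_⟩
  change A'.result x T v = g (f x v)
  rw [← hA x v, Algorithm.result, hrun]
  rfl

/-- Without communication, every vertex can output its identity and its input. -/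
theorem withIdentity : ComputableIn B 0 (fun (x : V → I) v => (v, x v)) :=
  ⟨{ State := V × I, init := fun v i => (v, i), send := fun _ _ _ => false, step := fun s _ => s,
     output := fun s => s }, fun _ _ => rfl⟩

/-- Two algorithms can be run one after the other. -/
theorem comp {f : (V → I) → V → J} {g : (V → J) → V → O}
    (hf : ComputableIn B T f) (hg : ComputableIn B T' g) :
    ComputableIn B (T + T') (fun x v => g (f x) v) := by
  classical
  obtain ⟨A, hA⟩ := hf
  obtain ⟨A', hA'⟩ := hg
  -- The counter `k` holds the rounds left for `A`. At zero the state is converted at once, so the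
  -- handover costs no round.
  let mk : ℕ → V → A.State → (ℕ × V × A.State) ⊕ A'.State := fun k v s =>
    if k = 0 then Sum.inr (A'.init v (A.output s)) else Sum.inl (k, v, s)
  let C : Algorithm V I (Option O) B :=
    { State := (ℕ × V × A.State) ⊕ A'.State
      init := fun v i => mk T v (A.init v i)
      send := fun s w => Sum.elim (fun p => A.send p.2.2 w) (fun p => A'.send p w) s
      step := fun s m => Sum.elim (fun p => mk (p.1 - 1) p.2.1 (A.step p.2.2 m))
        (fun p => Sum.inr (A'.step p m)) s
      output := fun s => Sum.elim (fun _ => none) (fun p => some (A'.output p)) s }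
  have h₁ : ∀ x t, t ≤ T → ∀ v, C.run x t v = mk (T - t) v (A.run x t v) := by
    intro x t
    induction t with
    | zero => intro _ v; rfl
    | succ t ih =>
      intro ht v
      have hne : T - t ≠ 0 := by omega
      have hs : T - t - 1 = T - (t + 1) := by omega
      simp only [Algorithm.run, ih (by omega), mk, hne, if_false, C, Sum.elim_inl, hs]
  have h₂ : ∀ x t v, C.run x (T + t) v = Sum.inr (A'.run (f x) t v) := by
    intro x t
    induction t with
    | zero =>
      intro v
      have := h₁ x T le_rfl v
      rw [add_zero, this]
      simp only [mk, Nat.sub_self, if_true, Algorithm.run]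
      rw [← hA x v]
      rfl
    | succ t ih =>
      intro v
      rw [← add_assoc]
      simp only [Algorithm.run, ih]
      rfl
  -- Stripping `some` needs a default element of `O`. If `O` is empty, then no pair of a vertex and
  -- an input exists, and an algorithm with empty state works.
  by_cases hO : Nonempty O
  · obtain ⟨o⟩ := hO
    have hC : ComputableIn B (T + T') (fun x v => some (g (f x) v)) :=
      ⟨C, fun x v => by
        change C.result x (T + T') v = some (g (f x) v)
        rw [← hA' (f x) v, Algorithm.result, h₂]
        rfl⟩
    exact hC.map (fun y => y.getD o)
  · by_cases hVI : Nonempty V ∧ Nonempty (V → I)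
    · obtain ⟨⟨v⟩, ⟨x⟩⟩ := hVI
      exact absurd ⟨g (f x) v⟩ hO
    · have e : V → I → False := fun v i => hVI ⟨⟨v⟩, ⟨fun _ => i⟩⟩
      exact ⟨{ State := Empty, init := fun v i => (e v i).elim, send := fun s => s.elim,
               step := fun s => s.elim, output := fun s => s.elim },
        fun x v => (e v (x v)).elim⟩

/-- In `R` rounds every vertex can send `R` prescribed messages to every vertex. -/
theorem messages (R : ℕ) (msg : V → I → V → ℕ → Fin B → Bool) :
    ComputableIn B R
      (fun (x : V → I) v => (x v, fun u j b => if j < R then msg u (x u) v j b else false)) := by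
  let A : Algorithm V I (I × (V → ℕ → Fin B → Bool)) B :=
    { State := V × I × ℕ × (V → ℕ → Fin B → Bool)
      init := fun v i => (v, i, 0, fun _ _ _ => false)
      send := fun s w => msg s.1 s.2.1 w s.2.2.1
      step := fun s m => (s.1, s.2.1, s.2.2.1 + 1,
        fun u j b => if j = s.2.2.1 then m u b else s.2.2.2 u j b)
      output := fun s => (s.2.1, s.2.2.2) }
  have h : ∀ x t v, A.run x t v =
      (v, x v, t, fun u j b => if j < t then msg u (x u) v j b else false) := by
    intro x t
    induction t with
    | zero => intro v; simp [Algorithm.run, A]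
    | succ t ih =>
      intro v
      simp only [Algorithm.run, ih]
      simp only [A, Prod.mk.injEq, true_and]
      funext u j b
      by_cases hj : j = t
      · subst hj; simp
      · have : j < t + 1 ↔ j < t := by omega
        simp [hj, this]
  exact ⟨A, fun x v => by rw [Algorithm.result, h]⟩

/-- If at most `R * B` bits, whose names `S u v` are known beforehand, are to be sent from `u` to
`v`, for all `u` and `v`, then `R` rounds suffice. -/
theorem transfer {β : Type} (R : ℕ) (S : V → V → Finset β) (hS : ∀ u v, (S u v).card ≤ R * B)
    (val : V → I → β → Prop) :
    ComputableIn B R (fun (x : V → I) v => (x v, fun u b => b ∈ S u v ∧ val u (x u) b)) := by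
  classical
  have hemb : ∀ u v, Nonempty (S u v ↪ Fin R × Fin B) := fun u v =>
    Function.Embedding.nonempty_of_card_le (by simpa using hS u v)
  -- Assigns each name a round and a position in that round's message. Sender and receiver share
  -- this table, so only values are transmitted.
  let enc : ∀ u v, S u v ↪ Fin R × Fin B := fun u v => (hemb u v).some
  have h := (messages (B := B) R (fun u (i : I) v j b =>
      decide (∃ a : S u v, ((enc u v a).1 : ℕ) = j ∧ (enc u v a).2 = b ∧ val u i a)))
  have h' := (h.comp (ComputableIn.withIdentity (B := B))).map
    (fun y : V × I × (V → ℕ → Fin B → Bool) => (y.2.1, fun u b => ∃ hb : b ∈ S u y.1,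
        y.2.2 u (enc u y.1 ⟨b, hb⟩).1 (enc u y.1 ⟨b, hb⟩).2 = true))
  refine cast ?_ h'
  congr 1
  funext x v
  simp only [Prod.mk.injEq, true_and]
  funext u b
  apply propext
  simp only [Fin.is_lt, if_true, decide_eq_true_eq]
  constructor
  · rintro ⟨hb, a, h1, h2, h3⟩
    have : a = ⟨b, hb⟩ := (enc u v).injective (Prod.ext (Fin.ext h1) h2)
    subst this
    exact ⟨hb, h3⟩
  · rintro ⟨hb, h3⟩
    exact ⟨hb, ⟨b, hb⟩, rfl, rfl, h3⟩

end ComputableIn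

/-! ### From knowledge of edges to enumeration -/

/-- The edges that a vertex `w` knows once it has learnt about all edges in `D`. -/
def knownEdges {V : Type} (H : Hypergraph V) (w : V) (D : Set (Set V)) : Set (Set V) :=
  {e | e ∈ H.edgeSet ∧ (w ∈ e ∨ e ∈ D)}

theorem exists_edge_eq_of_equiv {V : Type} {s t : TriSeq V} (h : TriSeq.SameCycle s t) (i : Fin 3) :
    ∃ j, t.e i = s.e j := by
  rcases h with ⟨k, h⟩ | ⟨k, h⟩
  · exact ⟨_, (h i).2⟩
  · exact ⟨_, (h i).2⟩

/-- It suffices that every potential triangle is known to some vertex. -/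
theorem solvableIn_of_computableIn {kind : TriKind} {r n B T : ℕ}
    (D : Fin n → Set (Set (Fin n)))
    (F : (Fin n → Set (Set (Fin n))) → Fin n → Set (Set (Fin n)))
    (hF : ComputableIn B T F)
    (hFD : ∀ H : Hypergraph (Fin n), IsUniformOn H r →
      ∀ w, F (localInput H) w = knownEdges H w (D w))
    (hD : ∀ t : TriSeq (Fin n), (∀ i, t.v i ∈ t.e i ∧ t.v (i + 1) ∈ t.e i) →
      (∀ i, (t.e i).ncard = r) → ∃ w, ∀ i, w ∈ t.e i ∨ t.e i ∈ D w) :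
    SolvableIn kind r n B T := by
  classical
  let Good : TriSeq (Fin n) → Prop := fun t =>
    (∀ i, t.v i ∈ t.e i ∧ t.v (i + 1) ∈ t.e i) ∧ kind.Selects t
  let Rep : Tri (Fin n) → TriSeq (Fin n) → Prop := fun Δ t =>
    Quotient.mk (triSetoid (Fin n)) t = Δ ∧ Good t
  -- Both choices depend on `Δ` but not on `H`. All vertices thus agree on the responsible one
  -- without communication, which makes the outputs disjoint.
  let Resp : Tri (Fin n) → Fin n → Prop := fun Δ w =>
    ∃ h : ∃ t, Rep Δ t, ∃ h' : ∃ w, ∀ i, w ∈ (h.choose).e i ∨ (h.choose).e i ∈ D w,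
      h'.choose = w
  obtain ⟨A, hA⟩ := (hF.comp ComputableIn.withIdentity).map
    (fun y => {Δ : Tri (Fin n) | Resp Δ y.1 ∧ ∃ h : ∃ t, Rep Δ t, ∀ i, (h.choose).e i ∈ y.2})
  refine ⟨A, fun H hH => ?_⟩
  have hres : A.result (localInput H) T = fun w => {Δ : Tri (Fin n) | Resp Δ w ∧
      ∃ h : ∃ t, Rep Δ t, ∀ i, (h.choose).e i ∈ knownEdges H w (D w)} := by
    funext w
    have := hA (localInput H) w
    simp only [hFD H hH] at this
    exact this
  rw [hres]
  constructor
  · intro u v huv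
    refine Set.disjoint_left.2 ?_
    rintro Δ ⟨⟨h, h', hu⟩, -⟩ ⟨⟨_, _, hv⟩, -⟩
    exact huv (hu.symm.trans hv)
  · ext Δ
    simp only [Set.mem_iUnion, Set.mem_ofPred_eq]
    constructor
    · rintro ⟨w, -, h, hk⟩
      obtain ⟨hq, hg⟩ := h.choose_spec
      exact ⟨h.choose, hq, fun i => ⟨(hk i).1, hg.1 i⟩, hg.2⟩
    · rintro ⟨t, hq, ht, hs⟩
      have h : ∃ t, Rep Δ t := ⟨t, hq, fun i => (ht i).2, hs⟩
      obtain ⟨hq', hg⟩ := h.choose_spec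
      have hE : ∀ i, (h.choose).e i ∈ H.edgeSet := by
        intro i
        obtain ⟨j, hj⟩ := exists_edge_eq_of_equiv (Quotient.exact (hq.trans hq'.symm)) i
        rw [hj]
        exact (ht j).1
      have h' := hD h.choose hg.1 (fun i => hH.2 _ (hE i))
      exact ⟨h'.choose, ⟨h, h', rfl⟩, h, fun i => ⟨hE i, h'.choose_spec i⟩⟩

/-- If two of the three vertices coincide, this vertex lies on all three edges. -/
theorem exists_mem_edges_of_not_injective {V : Type} {t : TriSeq V}
    (ht : ∀ i, t.v i ∈ t.e i ∧ t.v (i + 1) ∈ t.e i) (hv : ¬ Function.Injective t.v) :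
    ∃ w, ∀ i, w ∈ t.e i := by
  have key : ∀ i, t.v i = t.v (i + 1) → ∃ w, ∀ j, w ∈ t.e j := by
    intro i hi
    refine ⟨t.v i, fun j => ?_⟩
    have h3 : j = i ∨ j = i + 1 ∨ j + 1 = i := by clear hi; revert i j; decide
    rcases h3 with rfl | rfl | rfl
    · exact (ht _).1
    · rw [hi]; exact (ht _).1
    · exact (ht _).2
  simp only [Function.Injective, not_forall] at hv
  obtain ⟨i, j, hij, hne⟩ := hv
  have h2 : j = i + 1 ∨ i = j + 1 := by clear hij; revert i j; decide
  rcases h2 with rfl | rfl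
  · exact key _ hij
  · exact key _ hij.symm

/-- Edges with at most one vertex form only triangles that are known locally. -/
theorem solvableIn_zero {kind : TriKind} {r n B : ℕ} (hr : r ≤ 1) : SolvableIn kind r n B 0 := by
  refine solvableIn_of_computableIn (fun _ => ∅) (fun x w => x w)
    (ComputableIn.withIdentity.map Prod.snd) ?_ ?_
  · intro H _ w
    ext e
    simp [localInput, knownEdges]
  · intro t ht hc
    obtain ⟨w, hw⟩ := exists_mem_edges_of_not_injective ht (fun hinj => by
      have h := (Set.ncard_le_one_iff (Set.toFinite _)).1 ((hc 0).le.trans hr) (ht 0).1 (ht 0).2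
      exact absurd (hinj h) (by decide))
    exact ⟨w, fun i => Or.inl (hw i)⟩

/-- Every vertex `w` can learn about all edges that meet `Q w` twice, if there are an owner and an
intermediate vertex for every edge such that no link is overloaded. -/
theorem solvableIn_of_routing {kind : TriKind} {r n B R : ℕ} (Q : Fin n → Finset (Fin n))
    (hQ : ∀ v : Fin 3 → Fin n, ∃ w, ∀ i, v i ∈ Q w)
    (owner via : Finset (Fin n) → Fin n) (howner : ∀ e, e.card = r → owner e ∈ e)
    (h₁ : ∀ u p, (Finset.univ.filter fun e : Finset (Fin n) =>
      e.card = r ∧ owner e = u ∧ via e = p).card ≤ R * B)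
    (h₂ : ∀ p w, (Finset.univ.filter fun e : Finset (Fin n) =>
      e.card = r ∧ via e = p ∧ ∃ a ∈ e, ∃ b ∈ e, a ≠ b ∧ a ∈ Q w ∧ b ∈ Q w).card ≤ R * B) :
    SolvableIn kind r n B (R + R) := by
  classical
  -- The bit named `e` says whether `e` is an edge: its owner sends it to `via e`, which forwards it
  -- to every `w` whose `Q w` meets `e` twice.
  have c₁ := ComputableIn.transfer R _ h₁
    (fun (_ : Fin n) (x : Set (Set (Fin n))) (e : Finset (Fin n)) => (e : Set (Fin n)) ∈ x)
  have c₂ := ComputableIn.transfer R _ h₂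
    (fun (_ : Fin n) (y : Set (Set (Fin n)) × (Fin n → Finset (Fin n) → Prop))
      (e : Finset (Fin n)) => y.2 (owner e) e)
  have c := (c₁.comp c₂).map (fun y => y.1.1 ∪ {e | ∃ p, ∃ f : Finset (Fin n), ↑f = e ∧ y.2 p f})
  refine solvableIn_of_computableIn
    (fun w => {e | ∃ a ∈ e, ∃ b ∈ e, a ≠ b ∧ a ∈ Q w ∧ b ∈ Q w}) _ c ?_ ?_
  · intro H hH w
    ext e
    simp only [Set.mem_union, Set.mem_ofPred_eq, localInput, knownEdges, Finset.mem_filter,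
      Finset.mem_univ, true_and]
    constructor
    · rintro (⟨h, hw⟩ | ⟨p, f, rfl, ⟨-, -, hD⟩, -, h, -⟩)
      · exact ⟨h, Or.inl hw⟩
      · exact ⟨h, Or.inr hD⟩
    · rintro ⟨h, hw | hD⟩
      · exact Or.inl ⟨h, hw⟩
      · right
        have hf : ((Set.toFinite e).toFinset : Set (Fin n)) = e := (Set.toFinite e).coe_toFinset
        have hc : (Set.toFinite e).toFinset.card = r := by
          rw [← Set.ncard_eq_toFinset_card]; exact hH.2 e h
        refine ⟨via (Set.toFinite e).toFinset, (Set.toFinite e).toFinset, hf, ⟨hc, rfl, ?_⟩,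
          ⟨hc, rfl⟩, ?_⟩
        · simpa using hD
        · rw [hf]
          exact ⟨h, by simpa using howner _ hc⟩
  · intro t ht _
    by_cases hv : Function.Injective t.v
    · obtain ⟨w, hw⟩ := hQ t.v
      refine ⟨w, fun i => Or.inr ⟨t.v i, (ht i).1, t.v (i + 1), (ht i).2, fun h => ?_, hw _, hw _⟩⟩
      have h' := hv h
      clear h
      revert i
      decide
    · obtain ⟨w, hw⟩ := exists_mem_edges_of_not_injective ht hv
      exact ⟨w, fun i => Or.inl (hw i)⟩

/-! ### Digits and residue classes -/

/-- The number of `v < n` with `v % k ∈ P` and prescribed next digit to base `d`. -/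
theorem card_digit_le {n k d N : ℕ} (hn : n ≤ k * d * N) (P : Finset ℕ) (s : ℕ) :
    (Finset.univ.filter fun v : Fin n => (v : ℕ) % k ∈ P ∧ (v : ℕ) / k % d = s).card
      ≤ P.card * N := by
  calc _ ≤ (P ×ˢ Finset.range N).card := by
        refine Finset.card_le_card_of_injOn (fun v => ((v : ℕ) % k, (v : ℕ) / k / d)) ?_ ?_
        · intro v hv
          simp only [Finset.coe_filter, Finset.mem_univ, true_and, Set.mem_ofPred_eq] at hv
          simp only [Finset.coe_product, Set.mem_prod, Finset.mem_coe, Finset.mem_range]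
          refine ⟨hv.1, ?_⟩
          rw [Nat.div_div_eq_div_mul]
          exact Nat.div_lt_of_lt_mul (v.2.trans_le hn)
        · intro v hv w hw h
          simp only [Finset.coe_filter, Finset.mem_univ, true_and, Set.mem_ofPred_eq] at hv hw
          simp only [Prod.mk.injEq] at h
          have h1 : (v : ℕ) / k = (w : ℕ) / k := by
            rw [← Nat.div_add_mod ((v : ℕ) / k) d, ← Nat.div_add_mod ((w : ℕ) / k) d, h.2, hv.2,
              hw.2]
          apply Fin.ext
          rw [← Nat.div_add_mod (v : ℕ) k, ← Nat.div_add_mod (w : ℕ) k, h1, h.1]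
    _ = _ := by simp

/-- The three lowest digits of `w` to base `k`. -/
def digitSet (k w : ℕ) : Finset ℕ := {w % k, w / k % k, w / k / k % k}

theorem card_digitSet_le (k w : ℕ) : (digitSet k w).card ≤ 3 := Finset.card_le_three

/-- The vertices in the three residue classes modulo `k` assigned to `w`. -/
def residueClasses (n k : ℕ) (w : Fin n) : Finset (Fin n) :=
  Finset.univ.filter fun v : Fin n => (v : ℕ) % k ∈ digitSet k w

theorem mem_residueClasses {n k : ℕ} {w v : Fin n} :
    v ∈ residueClasses n k w ↔ (v : ℕ) % k ∈ digitSet k w := by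
  simp [residueClasses]

/-- The residues of the three vertices, read as base-`k` digits, spell a number below `k ^ 3 ≤ n`;
this number is `w`. -/
theorem exists_mem_residueClasses {n k : ℕ} (hk : 0 < k) (hkn : k ^ 3 ≤ n) (v : Fin 3 → Fin n) :
    ∃ w, ∀ i, v i ∈ residueClasses n k w := by
  have h : ∀ i, (v i : ℕ) % k < k := fun i => Nat.mod_lt _ hk
  set a := (v 0 : ℕ) % k with ha
  set b := (v 1 : ℕ) % k with hb
  set c := (v 2 : ℕ) % k with hc
  have hbc : b + k * c < k * k := by nlinarith [h 1, h 2]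
  have hlt : a + k * (b + k * c) < n := by
    refine lt_of_lt_of_le ?_ hkn
    have := h 0
    calc a + k * (b + k * c) < k * (b + k * c + 1) := by rw [mul_add k _ 1, mul_one]; omega
      _ ≤ k * (k * k) := Nat.mul_le_mul le_rfl hbc
      _ = k ^ 3 := by ring
  refine ⟨⟨_, hlt⟩, fun i => ?_⟩
  have e0 : (a + k * (b + k * c)) % k = a := by
    rw [Nat.add_mul_mod_self_left, Nat.mod_eq_of_lt (h 0)]
  have e1 : (a + k * (b + k * c)) / k = b + k * c := by
    rw [Nat.add_mul_div_left _ _ hk, Nat.div_eq_of_lt (h 0), zero_add]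
  have e2 : (b + k * c) % k = b := by rw [Nat.add_mul_mod_self_left, Nat.mod_eq_of_lt (h 1)]
  have e3 : (b + k * c) / k = c := by
    rw [Nat.add_mul_div_left _ _ hk, Nat.div_eq_of_lt (h 1), zero_add]
  have e4 : c % k = c := Nat.mod_eq_of_lt (h 2)
  rw [mem_residueClasses]
  simp only [digitSet, e0, e1, e2, e3, e4, Finset.mem_insert, Finset.mem_singleton]
  fin_cases i
  · exact Or.inl rfl
  · exact Or.inr (Or.inl rfl)
  · exact Or.inr (Or.inr rfl)

theorem card_residueClasses_le {n k : ℕ} (hn : n ≤ 8 * k ^ 3) (w : Fin n) :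
    (residueClasses n k w).card ≤ 24 * k ^ 2 := by
  -- With `d = 1` the condition on the next digit is void.
  have h := card_digit_le (n := n) (k := k) (d := 1) (N := 8 * k ^ 2)
    (hn.trans (by apply le_of_eq; ring)) (digitSet k w) 0
  simp only [Nat.mod_one, and_true] at h
  calc _ ≤ (digitSet k w).card * (8 * k ^ 2) := h
    _ ≤ 3 * (8 * k ^ 2) := Nat.mul_le_mul (card_digitSet_le k w) le_rfl
    _ = _ := by ring

/-! ### Balanced choice of intermediate vertices -/

/-- Intermediate vertices for edges with two vertices, read off from the digits of the vertices. -/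
theorem exists_routing_of_two {n k : ℕ} (hk : 0 < k) (hkn : k ^ 3 ≤ n) (hn : n ≤ 8 * k ^ 3) :
    ∃ owner via : Finset (Fin n) → Fin n, (∀ e, e.card = 2 → owner e ∈ e) ∧
      (∀ u p, (Finset.univ.filter fun e : Finset (Fin n) =>
        e.card = 2 ∧ owner e = u ∧ via e = p).card ≤ 576 * k) ∧
      (∀ p w, (Finset.univ.filter fun e : Finset (Fin n) =>
        e.card = 2 ∧ via e = p ∧ ∃ a ∈ e, ∃ b ∈ e, a ≠ b ∧
          a ∈ residueClasses n k w ∧ b ∈ residueClasses n k w).card ≤ 576 * k) := by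
  classical
  have hlt : ∀ a b : ℕ, a / k % k ^ 2 + k ^ 2 * (b / k % k) < n := by
    intro a b
    have h1 : a / k % k ^ 2 < k ^ 2 := Nat.mod_lt _ (by positivity)
    have h2 : b / k % k < k := Nat.mod_lt _ hk
    calc _ < k ^ 2 * (b / k % k + 1) := by rw [mul_add, mul_one]; omega
      _ ≤ k ^ 2 * k := Nat.mul_le_mul le_rfl h2
      _ = k ^ 3 := by ring
      _ ≤ n := hkn
  let z : Fin n := ⟨0, (pow_pos hk 3).trans_le hkn⟩
  let lo : Finset (Fin n) → Fin n := fun e => if h : e.Nonempty then e.min' h else z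
  let hi : Finset (Fin n) → Fin n := fun e => if h : e.Nonempty then e.max' h else z
  -- The digits used lie above the residues modulo `k`, so they are independent of membership in `Q
  -- w`. Fixing `via e` and `hi e` leaves at most `8 * k` values of `lo e`. Fixing `via e` and `w`
  -- leaves at most `3 * 8` values of `lo e` and `3 * (8 * k)` of `hi e`.
  let via : Finset (Fin n) → Fin n := fun e => ⟨_, hlt (lo e) (hi e)⟩
  have hpos : ∀ e : Finset (Fin n), e.card = 2 → e.Nonempty := fun e he =>
    Finset.card_pos.1 (by omega)
  have hlo : ∀ e, e.card = 2 → lo e ∈ e := fun e he => by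
    simp only [lo, hpos e he, dif_pos]; exact Finset.min'_mem _ _
  have hhi : ∀ e, e.card = 2 → hi e ∈ e := fun e he => by
    simp only [hi, hpos e he, dif_pos]; exact Finset.max'_mem _ _
  have hpair : ∀ e, e.card = 2 → e = {lo e, hi e} := by
    intro e he
    have hne : lo e ≠ hi e := by
      simp only [lo, hi, hpos e he, dif_pos]
      exact (Finset.min'_lt_max'_of_card e (by omega)).ne
    refine (Finset.eq_of_subset_of_card_le ?_ ?_).symm
    · intro x hx
      rcases Finset.mem_insert.1 hx with rfl | hx
      · exact hlo e he
      · rw [Finset.mem_singleton.1 hx]; exact hhi e he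
    · rw [he, Finset.card_pair hne]
  have hmod : ∀ e, (via e : ℕ) % k ^ 2 = (lo e : ℕ) / k % k ^ 2 := fun e => by
    simp only [via, Nat.add_mul_mod_self_left, Nat.mod_mod]
  have hdiv : ∀ e, (via e : ℕ) / k ^ 2 = (hi e : ℕ) / k % k := fun e => by
    simp only [via]
    rw [Nat.add_mul_div_left _ _ (by positivity),
      Nat.div_eq_of_lt (Nat.mod_lt _ (by positivity)), zero_add]
  refine ⟨hi, via, hhi, ?_, ?_⟩
  · intro u p
    have hc := card_digit_le (n := n) (k := k) (d := k ^ 2) (N := 8)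
      (hn.trans (by apply le_of_eq; ring)) (Finset.range k) ((p : ℕ) % k ^ 2)
    calc _ ≤ ((Finset.univ.filter fun v : Fin n => (v : ℕ) % k ∈ Finset.range k ∧
            (v : ℕ) / k % k ^ 2 = (p : ℕ) % k ^ 2).image
            fun a => ({a, u} : Finset (Fin n))).card := by
          refine Finset.card_le_card fun e hmem => ?_
          obtain ⟨he, rfl, rfl⟩ := (Finset.mem_filter.1 hmem).2
          refine Finset.mem_image.2 ⟨lo e, ?_, (hpair e he).symm⟩
          simp [hmod, Nat.mod_lt _ hk]
      _ ≤ _ := Finset.card_image_le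
      _ ≤ _ := hc
      _ ≤ 576 * k := by rw [Finset.card_range]; omega
  · intro p w
    have hc₁ := card_digit_le (n := n) (k := k) (d := k ^ 2) (N := 8)
      (hn.trans (by apply le_of_eq; ring)) (digitSet k w) ((p : ℕ) % k ^ 2)
    have hc₂ := card_digit_le (n := n) (k := k) (d := k) (N := 8 * k)
      (hn.trans (by apply le_of_eq; ring)) (digitSet k w) ((p : ℕ) / k ^ 2)
    calc _ ≤ (((Finset.univ.filter fun v : Fin n => (v : ℕ) % k ∈ digitSet k w ∧
            (v : ℕ) / k % k ^ 2 = (p : ℕ) % k ^ 2) ×ˢ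
          (Finset.univ.filter fun v : Fin n => (v : ℕ) % k ∈ digitSet k w ∧
            (v : ℕ) / k % k = (p : ℕ) / k ^ 2)).image
            fun x => ({x.1, x.2} : Finset (Fin n))).card := by
          refine Finset.card_le_card fun e hmem => ?_
          obtain ⟨he, rfl, a, ha, b, hb, hab, haQ, hbQ⟩ := (Finset.mem_filter.1 hmem).2
          have hsub : e = {a, b} := by
            refine (Finset.eq_of_subset_of_card_le ?_ ?_).symm
            · intro x hx
              rcases Finset.mem_insert.1 hx with rfl | hx
              · exact ha
              · rw [Finset.mem_singleton.1 hx]; exact hb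
            · rw [he, Finset.card_pair hab]
          have hQ : ∀ x ∈ e, (x : ℕ) % k ∈ digitSet k w := by
            intro x hx
            rw [hsub] at hx
            rcases Finset.mem_insert.1 hx with rfl | hx
            · exact mem_residueClasses.1 haQ
            · rw [Finset.mem_singleton.1 hx]; exact mem_residueClasses.1 hbQ
          refine Finset.mem_image.2 ⟨(lo e, hi e), ?_, (hpair e he).symm⟩
          simp [hmod, hdiv, hQ _ (hlo e he), hQ _ (hhi e he)]
      _ ≤ _ := Finset.card_image_le
      _ ≤ (3 * 8) * (3 * (8 * k)) := by
          rw [Finset.card_product]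
          exact Nat.mul_le_mul (hc₁.trans (Nat.mul_le_mul (card_digitSet_le k w) le_rfl))
            (hc₂.trans (Nat.mul_le_mul (card_digitSet_le k w) le_rfl))
      _ = 576 * k := by ring

theorem card_powersetCard_univ_le (n m : ℕ) :
    (Finset.powersetCard m (Finset.univ : Finset (Fin n))).card ≤ n ^ m := by
  rw [Finset.card_powersetCard, Finset.card_univ, Fintype.card_fin]
  exact Nat.choose_le_pow _ _

/-- For edges with at least three vertices, the sum of the vertices modulo `n` can serve as
the intermediate vertex. -/
theorem exists_routing_of_three_le {n k r : ℕ} (hk : 0 < k) (hkn : k ^ 3 ≤ n) (hn : n ≤ 8 * k ^ 3)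
    (hr : 3 ≤ r) :
    ∃ owner via : Finset (Fin n) → Fin n, (∀ e, e.card = r → owner e ∈ e) ∧
      (∀ u p, (Finset.univ.filter fun e : Finset (Fin n) =>
        e.card = r ∧ owner e = u ∧ via e = p).card ≤ 576 * k * n ^ (r - 2)) ∧
      (∀ p w, (Finset.univ.filter fun e : Finset (Fin n) =>
        e.card = r ∧ via e = p ∧ ∃ a ∈ e, ∃ b ∈ e, a ≠ b ∧
          a ∈ residueClasses n k w ∧ b ∈ residueClasses n k w).card ≤ 576 * k * n ^ (r - 2)) := by
  classical
  have hn0 : 0 < n := (pow_pos hk 3).trans_le hkn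
  have : NeZero n := ⟨hn0.ne'⟩
  let owner : Finset (Fin n) → Fin n := fun e => if h : e.Nonempty then h.choose else 0
  have howner : ∀ e, e.card = r → owner e ∈ e := by
    intro e he
    have h : e.Nonempty := Finset.card_pos.1 (by omega)
    simp only [owner, h, dif_pos]
    exact h.choose_spec
  -- Once the sum is fixed, any one vertex is determined by the others. This saves a factor `n` in
  -- both hops: `r - 2` vertices stay free besides the owner, and `r - 3` besides the two in `Q w`.
  refine ⟨owner, fun e => ∑ x ∈ e, x, howner, ?_, ?_⟩
  · intro u p
    calc _ ≤ ((Finset.powersetCard (r - 2) (Finset.univ : Finset (Fin n))).image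
            fun s => insert u (insert (p - u - ∑ x ∈ s, x) s)).card := by
          refine Finset.card_le_card fun e hmem => ?_
          obtain ⟨he, rfl, rfl⟩ := (Finset.mem_filter.1 hmem).2
          have hu := howner e he
          set u := owner e
          have hc1 : (e.erase u).card = r - 1 := by rw [Finset.card_erase_of_mem hu, he]
          obtain ⟨c, hc⟩ : (e.erase u).Nonempty := Finset.card_pos.1 (by omega)
          refine Finset.mem_image.2 ⟨(e.erase u).erase c, ?_, ?_⟩
          · rw [Finset.mem_powersetCard]
            refine ⟨Finset.subset_univ _, ?_⟩
            rw [Finset.card_erase_of_mem hc, hc1]; omega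
          · have hsum : ∑ x ∈ e, x - u - ∑ x ∈ (e.erase u).erase c, x = c := by
              rw [← Finset.add_sum_erase e _ hu, ← Finset.add_sum_erase (e.erase u) _ hc]
              abel
            rw [hsum, Finset.insert_erase hc, Finset.insert_erase hu]
      _ ≤ _ := Finset.card_image_le
      _ ≤ n ^ (r - 2) := card_powersetCard_univ_le _ _
      _ ≤ 576 * k * n ^ (r - 2) := Nat.le_mul_of_pos_left _ (by omega)
  · intro p w
    calc _ ≤ ((residueClasses n k w ×ˢ residueClasses n k w ×ˢ
            Finset.powersetCard (r - 3) (Finset.univ : Finset (Fin n))).image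
            fun y => insert y.1 (insert y.2.1
              (insert (p - y.1 - y.2.1 - ∑ x ∈ y.2.2, x) y.2.2))).card := by
          refine Finset.card_le_card fun e hmem => ?_
          obtain ⟨he, rfl, a, ha, b, hb, hab, haQ, hbQ⟩ := (Finset.mem_filter.1 hmem).2
          have hb' : b ∈ e.erase a := Finset.mem_erase.2 ⟨hab.symm, hb⟩
          have hc1 : (e.erase a).card = r - 1 := by rw [Finset.card_erase_of_mem ha, he]
          have hc2 : ((e.erase a).erase b).card = r - 2 := by
            rw [Finset.card_erase_of_mem hb', hc1]; omega
          obtain ⟨c, hc⟩ : ((e.erase a).erase b).Nonempty := Finset.card_pos.1 (by omega)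
          refine Finset.mem_image.2 ⟨(a, b, ((e.erase a).erase b).erase c), ?_, ?_⟩
          · simp only [Finset.mem_product, Finset.mem_powersetCard]
            refine ⟨haQ, hbQ, Finset.subset_univ _, ?_⟩
            rw [Finset.card_erase_of_mem hc, hc2]; omega
          · have hsum : ∑ x ∈ e, x - a - b - ∑ x ∈ ((e.erase a).erase b).erase c, x = c := by
              rw [← Finset.add_sum_erase e _ ha, ← Finset.add_sum_erase (e.erase a) _ hb',
                ← Finset.add_sum_erase ((e.erase a).erase b) _ hc]
              abel
            simp only [hsum]
            rw [Finset.insert_erase hc, Finset.insert_erase hb', Finset.insert_erase ha]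
      _ ≤ _ := Finset.card_image_le
      _ ≤ 24 * k ^ 2 * (24 * k ^ 2 * n ^ (r - 3)) := by
          rw [Finset.card_product, Finset.card_product]
          have := card_residueClasses_le hn w
          exact Nat.mul_le_mul this (Nat.mul_le_mul this (card_powersetCard_univ_le _ _))
      _ = 576 * k * (k ^ 3 * n ^ (r - 3)) := by ring
      _ ≤ 576 * k * (n * n ^ (r - 3)) := by gcongr
      _ = 576 * k * n ^ (r - 2) := by
          rw [← pow_succ', show r - 3 + 1 = r - 2 by omega]

/-! ### The number of rounds -/

theorem solvableIn_of_load {kind : TriKind} {r n k B R : ℕ} (hr : 2 ≤ r) (hk : 0 < k)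
    (hkn : k ^ 3 ≤ n) (hn : n ≤ 8 * k ^ 3) (hR : 576 * k * n ^ (r - 2) ≤ R * B) :
    SolvableIn kind r n B (R + R) := by
  rcases hr.eq_or_lt with rfl | hr
  · obtain ⟨owner, via, ho, h₁, h₂⟩ := exists_routing_of_two hk hkn hn
    have hR' : 576 * k ≤ R * B := by simpa using hR
    exact solvableIn_of_routing _ (exists_mem_residueClasses hk hkn) owner via ho
      (fun u p => (h₁ u p).trans hR') (fun p w => (h₂ p w).trans hR')
  · obtain ⟨owner, via, ho, h₁, h₂⟩ := exists_routing_of_three_le hk hkn hn hr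
    exact solvableIn_of_routing _ (exists_mem_residueClasses hk hkn) owner via ho
      (fun u p => (h₁ u p).trans hR) (fun p w => (h₂ p w).trans hR)

theorem exists_cube_root (n : ℕ) : ∃ k, k ^ 3 ≤ n ∧ n < (k + 1) ^ 3 := by
  induction n with
  | zero => exact ⟨0, by norm_num⟩
  | succ n ih =>
    obtain ⟨k, h₁, h₂⟩ := ih
    by_cases h : n + 1 < (k + 1) ^ 3
    · exact ⟨k, by omega, h⟩
    · refine ⟨k + 1, by omega, ?_⟩
      have : (k + 1) ^ 3 < (k + 1 + 1) ^ 3 := Nat.pow_lt_pow_left (by omega) (by norm_num)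
      omega

end CliqueModel

theorem theorem3p1 :
    ∀ c : ℝ, 0 < c → ∃ C : ℝ, 0 < C ∧
      ∀ (kind : CliqueModel.TriKind) (r n B : ℕ), 2 ≤ n → c * Real.log (n : ℝ) ≤ (B : ℝ) →
        ∃ T : ℕ, (T : ℝ) ≤ C * ((n : ℝ) ^ ((r : ℝ) - 5 / 3) / Real.log (n : ℝ)) ∧
          CliqueModel.SolvableIn kind r n B T := by
  intro c hc
  -- Each of the two hops contributes `576 / c` from the load and `3` from rounding up, the latter
  -- because `Real.log n ≤ 3 * X`.
  refine ⟨1152 / c + 6, by positivity, fun kind r n B hn hB => ?_⟩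
  have hn1 : (1 : ℝ) < n := by exact_mod_cast hn
  have hn0 : (0 : ℝ) < n := by linarith
  have hlog : 0 < Real.log n := Real.log_pos hn1
  rcases Nat.lt_or_ge r 2 with hr | hr
  · exact ⟨0, by rw [Nat.cast_zero]; positivity, CliqueModel.solvableIn_zero (by omega)⟩
  obtain ⟨k, hk₁, hk₂⟩ := CliqueModel.exists_cube_root n
  have hk : 0 < k := by
    rcases Nat.eq_zero_or_pos k with rfl | h
    · norm_num at hk₂; omega
    · exact h
  have hn8 : n ≤ 8 * k ^ 3 := by
    have : (k + 1) ^ 3 ≤ (2 * k) ^ 3 := Nat.pow_le_pow_left (by omega) 3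
    rw [mul_pow] at this
    omega
  have hB0 : (0 : ℝ) < B := lt_of_lt_of_le (by positivity) hB
  have hB1 : 0 < B := by exact_mod_cast hB0
  set M := 576 * k * n ^ (r - 2) with hM
  refine ⟨(M / B + 1) + (M / B + 1), ?_, CliqueModel.solvableIn_of_load hr hk hk₁ hn8 ?_⟩
  · set X : ℝ := (n : ℝ) ^ ((r : ℝ) - 5 / 3) with hX
    have hkX : (k : ℝ) ≤ (n : ℝ) ^ (1 / 3 : ℝ) := by
      have h : ((k : ℝ) ^ 3) ^ (1 / 3 : ℝ) ≤ (n : ℝ) ^ (1 / 3 : ℝ) :=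
        Real.rpow_le_rpow (by positivity) (by exact_mod_cast hk₁) (by norm_num)
      rwa [← Real.rpow_natCast, ← Real.rpow_mul (by positivity), Nat.cast_ofNat,
        mul_one_div_cancel (by norm_num), Real.rpow_one] at h
    have hMX : (M : ℝ) ≤ 576 * X := by
      have hsplit : X = (n : ℝ) ^ (1 / 3 : ℝ) * (n : ℝ) ^ (r - 2) := by
        rw [← Real.rpow_natCast, ← Real.rpow_add hn0, Nat.cast_sub hr, hX]
        congr 1
        push_cast
        ring
      rw [hM, hsplit]
      push_cast
      rw [mul_assoc]
      gcongr
    have hlogX : Real.log n ≤ 3 * X := by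
      have h1 : Real.log n ≤ (n : ℝ) ^ (1 / 3 : ℝ) / (1 / 3) :=
        Real.log_le_rpow_div hn0.le (by norm_num)
      have h2 : (n : ℝ) ^ (1 / 3 : ℝ) ≤ X := by
        refine Real.rpow_le_rpow_of_exponent_le hn1.le ?_
        have : (2 : ℝ) ≤ r := by exact_mod_cast hr
        linarith
      linarith
    have hX0 : 0 ≤ X := by positivity
    have hdiv : ((M / B : ℕ) : ℝ) ≤ 576 * X / (c * Real.log n) :=
      Nat.cast_div_le.trans (div_le_div₀ (by positivity) hMX (by positivity) hB)
    have h1 : 1 ≤ 3 * X / Real.log n := (one_le_div hlog).2 hlogX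
    push_cast
    calc _ ≤ (576 * X / (c * Real.log n) + 3 * X / Real.log n)
          + (576 * X / (c * Real.log n) + 3 * X / Real.log n) := by gcongr
      _ = (1152 / c + 6) * (X / Real.log n) := by field_simp; ring
  · have := Nat.div_add_mod M B
    have := Nat.mod_lt M hB1
    calc M ≤ B * (M / B) + B := by omega
      _ = (M / B + 1) * B := by ring
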